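/- Let $d,m\ge 0$ be integers, $\mathcal H=\mathbb C^d$, and let $L_1,\dots,L_m\in\mathcal B(\mathcal H)$ be arbitrary operators. Put $\mathcal D=\sum_{j=1}^m\mathcal D_{L_j}$, where $\mathcal D_{L}(\rho)=L\rho L^\dagger-\tfrac12\left(L^\dagger L\rho+\rho L^\dagger L\right)$. For a time-dependent Hamiltonian $H$, i.e. a map $t\mapsto H(t)$ from $\mathbb R$ to the Hermitian operators on $\mathcal H$ whose matrix entries are locally integrable, let $\mathcal L_t=-i[H(t),\,\cdot\,]+\mathcal D$ and, for $t\ge s$, let $$\mathcal E_{t,s}=\mathcal T\exp\left(\int_s^t\mathcal L_\tau\,d\tau\right)=\sum_{n\ge 0}\int_{s\le\tau_1\le\dots\le\tau_n\le t}\mathcal L_{\tau_n}\cdots\mathcal L_{\tau_1}\,d\tau_1\cdots d\tau_n$$ be the associated time evolution. A quantum state is a positive semidefinite operator of trace $1$, and $\|\cdot\|_1$ is the trace norm (the sum of the singular values). The family $\mathcal L_t$ is called exponentially contractive if there are $K,\gamma>0$ such that $$\|\mathcal E_{t,s}(\rho-\sigma)\|_1\le K e^{-\gamma|t-s|}\,\|\rho-\sigma\|_1$$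 for all quantum states $\rho,\sigma$ and all $t\ge s\ge 0$. The dissipator $\mathcal D$ is called Hamiltonian-independently contractive if $\mathcal L_t=-i[H(t),\,\cdot\,]+\mathcal D$ is exponentially contractive for every time-dependent Hamiltonian $H$ as above. Suppose that $\{L_j,L_j^\dagger\}_j$ spans all anti-Hermitian operators over $\mathbb C$, that is, $$\{X\in\mathcal B(\mathcal H)\mid X=-X^\dagger\}\subseteq\operatorname{span}_{\mathbb C}\left(\{L_j\}_j\cup\{L_j^\dagger\}_j\right).$$ Then $\mathcal D$ is Hamiltonian-independently contractive. -/

import Mathlib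

open MeasureTheory
open scoped ComplexOrder

namespace Lindblad

/-- Operators on the Hilbert space `ℂ^d`, written as matrices in the standard basis. -/
abbrev Op (d : ℕ) : Type := Matrix (Fin d) (Fin d) ℂ

/-- Linear superoperators on `Op d`. -/
abbrev SuperOp (d : ℕ) : Type := Op d →ₗ[ℂ] Op d

/-- The dissipator `ρ ↦ L ρ L† - {L† L, ρ} / 2` of one jump operator `L`. -/
noncomputable def jumpDissipator {d : ℕ} (L : Op d) : SuperOp d where
  toFun ρ := L * ρ * L.conjTranspose -
    (1 / 2 : ℂ) • (L.conjTranspose * L * ρ + ρ * (L.conjTranspose * L))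
  map_add' x y := by
    simp only [mul_add, add_mul, smul_add]; abel
  map_smul' c x := by
    simp only [mul_smul_comm, smul_mul_assoc, RingHom.id_apply, smul_sub, smul_add,
      smul_comm c (1 / 2 : ℂ)]

/-- The dissipator `∑ j, 𝒟_{L j}` of a finite family of jump operators. -/
noncomputable def dissipator {d m : ℕ} (L : Fin m → Op d) : SuperOp d :=
  ∑ j, jumpDissipator (L j)

/-- The superoperator `ρ ↦ -i [H, ρ]`. -/
noncomputable def hamiltonianPart {d : ℕ} (H : Op d) : SuperOp d where
  toFun ρ := -Complex.I • (H * ρ - ρ * H)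
  map_add' x y := by
    simp only [mul_add, add_mul, ← smul_add]; congr 1; abel
  map_smul' c x := by
    simp only [mul_smul_comm, smul_mul_assoc, RingHom.id_apply, ← smul_sub]
    rw [smul_comm]

/-- The driven Lindbladian `ℒ_t = -i [H(t), · ] + 𝒟`. -/
noncomputable def drivenLindbladian {d : ℕ} (H : ℝ → Op d) (D : SuperOp d) (t : ℝ) : SuperOp d :=
  hamiltonianPart (H t) + D

/-- A time-dependent Hamiltonian: Hermitian at every time, with locally integrable entries. -/
structure IsHamiltonian {d : ℕ} (H : ℝ → Op d) : Prop where
  isHermitian : ∀ t, (H t).IsHermitian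
  locallyIntegrable : ∀ i j, LocallyIntegrable (fun t => H t i j) volume

/-- The terms of the Dyson series of `ℒ` started at time `s` at the operator `x`. The `n`-th term
at time `t` is the time-ordered integral
`∫_{s ≤ τ₁ ≤ ⋯ ≤ τₙ ≤ t} ℒ_{τₙ} ⋯ ℒ_{τ₁} x dτ₁ ⋯ dτₙ`, here as an iterated integral. Integrals
of matrix-valued functions are taken entrywise. -/
noncomputable def dysonTerm {d : ℕ} (𝓛 : ℝ → SuperOp d) (s : ℝ) (x : Op d) : ℕ → ℝ → Op d
  | 0 => fun _ => x
  | n + 1 => fun t => Matrix.of fun i j => ∫ τ in s..t, (𝓛 τ (dysonTerm 𝓛 s x n τ)) i j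

/-- The time-evolution map `ℰ_{t,s} = 𝒯 exp (∫_s^t ℒ_τ dτ)` applied to `x`: the time-ordered
exponential is the sum of the Dyson series. -/
noncomputable def timeEvolution {d : ℕ} (𝓛 : ℝ → SuperOp d) (t s : ℝ) (x : Op d) : Op d :=
  ∑' n, dysonTerm 𝓛 s x n t

/-- Quantum states: positive semidefinite operators of trace one. -/
def IsState {d : ℕ} (ρ : Op d) : Prop :=
  ρ.PosSemidef ∧ ρ.trace = 1

/-- The trace norm `‖A‖₁`, the sum of the singular values of `A`, i.e. of the square roots of the
eigenvalues of `A† A` counted with multiplicity. -/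
noncomputable def traceNorm {d : ℕ} (A : Op d) : ℝ :=
  ∑ i, √((Matrix.isHermitian_conjTranspose_mul_self A).eigenvalues i)

/-- Exponential contractivity of a time-dependent Lindbladian in trace norm. -/
def ExponentiallyContractive {d : ℕ} (𝓛 : ℝ → SuperOp d) : Prop :=
  ∃ K γ : ℝ, 0 < K ∧ 0 < γ ∧ ∀ ρ σ : Op d, IsState ρ → IsState σ →
    ∀ s t : ℝ, 0 ≤ s → s ≤ t →
      traceNorm (timeEvolution 𝓛 t s (ρ - σ)) ≤
        K * Real.exp (-γ * |t - s|) * traceNorm (ρ - σ)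

/-- `𝒟` is Hamiltonian-independently contractive if `-i [H(t), · ] + 𝒟` is exponentially
contractive for every time-dependent Hamiltonian `H`. -/
def HamiltonianIndependentlyContractive {d : ℕ} (D : SuperOp d) : Prop :=
  ∀ H : ℝ → Op d, IsHamiltonian H → ExponentiallyContractive (drivenLindbladian H D)

end Lindblad

/-! A difference of states is Hermitian and traceless, and the evolution keeps it so. For such an
operator `Y`, let `n` be the sum of the absolute values of its negative eigenvalues. Then `n` is the
maximum of `-tr (Q Y)` over projections `Q`, attained at the negative spectral projection `P`, and
since the trace vanishes it is half the trace norm. It serves as a Lyapunov function.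

As `P` commutes with `Y`, `tr (P [H, Y]) = 0`, so no Hamiltonian affects `n` to first order. In an
eigenbasis of `Y` the dissipator acts on `tr (P Y)` like a classical jump process with rates `|⟨l|L
j|k⟩|²`, and every transfer between negative and nonnegative eigenvalues decreases `n`. The spanning
hypothesis bounds the symmetrized rates below uniformly in the basis
(`exists_pos_le_sum_norm_apply`), and a pigeonhole argument finds a large negative and a large
positive eigenvalue that exchange weight (`sum_neg_part_le_sum_transfer`). Hence `n` decays at a
rate `κ` depending only on the jump operators (`exists_negative_projection`).

The Hamiltonian is only locally integrable and `P` need not vary continuously, so the decay is not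
obtained by differentiation. The projection is frozen at the right end of a short interval, where
the maximum principle compares it with `n` at earlier times; `le_of_eventually_nhdsLT_le` globalizes
this local estimate in `exists_exp_decay`. -/

namespace Lindblad

/-! ### Entrywise norm, projections and comparison with the trace norm -/

variable {d m : ℕ}

/-- The entrywise `ℓ¹` norm of an operator. -/
noncomputable def entryNorm (A : Op d) : ℝ := ∑ i, ∑ j, ‖A i j‖

theorem entryNorm_nonneg (A : Op d) : 0 ≤ entryNorm A :=
  Finset.sum_nonneg fun _ _ => Finset.sum_nonneg fun _ _ => norm_nonneg _

theorem norm_apply_le_entryNorm (A : Op d) (i j : Fin d) : ‖A i j‖ ≤ entryNorm A :=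
  (Finset.single_le_sum (f := fun j => ‖A i j‖) (fun _ _ => norm_nonneg _)
    (Finset.mem_univ j)).trans
  (Finset.single_le_sum (f := fun i => ∑ j, ‖A i j‖)
    (fun _ _ => Finset.sum_nonneg fun _ _ => norm_nonneg _) (Finset.mem_univ i))

theorem entryNorm_add_le (A B : Op d) : entryNorm (A + B) ≤ entryNorm A + entryNorm B := by
  simp only [entryNorm, ← Finset.sum_add_distrib]
  exact Finset.sum_le_sum fun i _ => Finset.sum_le_sum fun j _ => norm_add_le _ _

theorem entryNorm_smul (c : ℂ) (A : Op d) : entryNorm (c • A) = ‖c‖ * entryNorm A := by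
  simp [entryNorm, Finset.mul_sum]

theorem entryNorm_sub_le (A B : Op d) : entryNorm (A - B) ≤ entryNorm A + entryNorm B := by
  have := entryNorm_add_le A ((-1 : ℂ) • B)
  rw [entryNorm_smul] at this
  simpa [sub_eq_add_neg] using this

theorem entryNorm_sum_le {ι : Type*} (s : Finset ι) (A : ι → Op d) :
    entryNorm (∑ k ∈ s, A k) ≤ ∑ k ∈ s, entryNorm (A k) :=
  Finset.le_sum_of_subadditive entryNorm (by simp [entryNorm]) entryNorm_add_le s A

theorem entryNorm_mul_le (A B : Op d) : entryNorm (A * B) ≤ entryNorm A * entryNorm B := by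
  have hrow : ∀ k, ∑ j, ‖B k j‖ ≤ entryNorm B := fun k =>
    Finset.single_le_sum (f := fun k => ∑ j, ‖B k j‖)
      (fun _ _ => Finset.sum_nonneg fun _ _ => norm_nonneg _) (Finset.mem_univ k)
  rw [entryNorm, entryNorm, Finset.sum_mul]
  refine Finset.sum_le_sum fun i _ => ?_
  calc ∑ j, ‖(A * B) i j‖ ≤ ∑ j, ∑ k, ‖A i k‖ * ‖B k j‖ :=
        Finset.sum_le_sum fun j _ => by
          rw [Matrix.mul_apply]
          exact (norm_sum_le _ _).trans_eq (by simp)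
    _ = ∑ k, ‖A i k‖ * ∑ j, ‖B k j‖ := by
        rw [Finset.sum_comm]; simp [Finset.mul_sum]
    _ ≤ (∑ k, ‖A i k‖) * entryNorm B := by
        rw [Finset.sum_mul]
        exact Finset.sum_le_sum fun k _ => mul_le_mul_of_nonneg_left (hrow k) (norm_nonneg _)

theorem exists_entryNorm_map_le (D : SuperOp d) :
    ∃ C : ℝ, 0 ≤ C ∧ ∀ A, entryNorm (D A) ≤ C * entryNorm A := by
  refine ⟨∑ i, ∑ j, entryNorm (D (Matrix.single i j 1)),
    Finset.sum_nonneg fun _ _ => Finset.sum_nonneg fun _ _ => entryNorm_nonneg _, fun A => ?_⟩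
  conv_lhs => rw [Matrix.matrix_eq_sum_single A]
  simp only [map_sum, Finset.sum_mul]
  refine (entryNorm_sum_le _ _).trans (Finset.sum_le_sum fun i _ =>
    (entryNorm_sum_le _ _).trans (Finset.sum_le_sum fun j _ => ?_))
  have : Matrix.single i j (A i j) = A i j • Matrix.single i j (1 : ℂ) := by simp
  rw [this, map_smul, entryNorm_smul, mul_comm]
  exact mul_le_mul_of_nonneg_left (norm_apply_le_entryNorm A i j) (entryNorm_nonneg _)

theorem norm_trace_mul_le (P A : Op d) (hP : ∀ i j, ‖P i j‖ ≤ 1) :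
    ‖(P * A).trace‖ ≤ entryNorm A := by
  rw [Matrix.trace_mul_comm, Matrix.trace, entryNorm]
  refine (norm_sum_le _ _).trans (Finset.sum_le_sum fun i _ => ?_)
  rw [Matrix.diag_apply, Matrix.mul_apply]
  refine (norm_sum_le _ _).trans (Finset.sum_le_sum fun j _ => ?_)
  rw [norm_mul]
  exact mul_le_of_le_one_right (norm_nonneg _) (hP _ _)

theorem diag_eq_sum_of_isStarProjection {P : Op d} (hP : IsStarProjection P) (i : Fin d) :
    (P i i).re = ∑ k, ‖P i k‖ ^ 2 := by
  have h1 : P * P.conjTranspose = P := by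
    have h2 : P.conjTranspose = P := hP.isSelfAdjoint
    rw [h2]; exact hP.isIdempotentElem
  have h3 := congrFun (congrFun h1 i) i
  rw [Matrix.mul_apply] at h3
  rw [← h3]
  simp [Matrix.conjTranspose_apply, Complex.mul_conj, Complex.normSq_eq_norm_sq]
  norm_cast

theorem diag_nonneg_of_isStarProjection {P : Op d} (hP : IsStarProjection P) (i : Fin d) :
    0 ≤ (P i i).re := by
  rw [diag_eq_sum_of_isStarProjection hP]; positivity

theorem sq_norm_apply_le_diag_of_isStarProjection {P : Op d} (hP : IsStarProjection P)
    (i j : Fin d) : ‖P i j‖ ^ 2 ≤ (P i i).re := by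
  rw [diag_eq_sum_of_isStarProjection hP]
  exact Finset.single_le_sum (f := fun k => ‖P i k‖ ^ 2) (fun _ _ => by positivity)
    (Finset.mem_univ j)

theorem diag_le_one_of_isStarProjection {P : Op d} (hP : IsStarProjection P) (i : Fin d) :
    (P i i).re ≤ 1 := by
  have h1 := sq_norm_apply_le_diag_of_isStarProjection hP i i
  have h2 := Complex.re_le_norm (P i i)
  have h3 := norm_nonneg (P i i)
  nlinarith

theorem norm_apply_le_one_of_isStarProjection {P : Op d} (hP : IsStarProjection P)
    (i j : Fin d) : ‖P i j‖ ≤ 1 := by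
  have h1 := sq_norm_apply_le_diag_of_isStarProjection hP i j
  have h2 := diag_le_one_of_isStarProjection hP i
  have h3 := norm_nonneg (P i j)
  nlinarith

/-- Both sides are `tr (A† A)`. This squared Hilbert–Schmidt norm mediates between the trace norm
and the entrywise norm. -/
theorem sum_eigenvalues_conjTranspose_mul_self (A : Op d) :
    ∑ i, (Matrix.isHermitian_conjTranspose_mul_self A).eigenvalues i =
      ∑ i, ∑ j, ‖A i j‖ ^ 2 := by
  have h := (Matrix.isHermitian_conjTranspose_mul_self A).trace_eq_sum_eigenvalues
  have h2 : (A.conjTranspose * A).trace = ((∑ i, ∑ j, ‖A i j‖ ^ 2 : ℝ) : ℂ) := by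
    rw [Finset.sum_comm]
    simp [Matrix.trace, Matrix.mul_apply, Matrix.conjTranspose_apply, Complex.conj_mul']
  rw [h2] at h
  have h3 := congrArg Complex.re h
  rw [Complex.ofReal_re] at h3
  rw [h3, Complex.re_sum]
  rfl

theorem eigenvalues_conjTranspose_mul_self_nonneg (A : Op d) (i : Fin d) :
    0 ≤ (Matrix.isHermitian_conjTranspose_mul_self A).eigenvalues i :=
  (Matrix.posSemidef_conjTranspose_mul_self A).eigenvalues_nonneg i

theorem traceNorm_nonneg (A : Op d) : 0 ≤ traceNorm A :=
  Finset.sum_nonneg fun _ _ => Real.sqrt_nonneg _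

theorem traceNorm_le (A : Op d) : traceNorm A ≤ d * entryNorm A := by
  have hA : ∀ i, √((Matrix.isHermitian_conjTranspose_mul_self A).eigenvalues i) ≤ entryNorm A := by
    intro i
    apply Real.sqrt_le_iff.mpr ⟨entryNorm_nonneg A, ?_⟩
    calc _ ≤ ∑ i, (Matrix.isHermitian_conjTranspose_mul_self A).eigenvalues i :=
          Finset.single_le_sum (fun i _ => eigenvalues_conjTranspose_mul_self_nonneg A i)
            (Finset.mem_univ i)
      _ = ∑ i, ∑ j, ‖A i j‖ ^ 2 := sum_eigenvalues_conjTranspose_mul_self A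
      _ ≤ ∑ i, ∑ j, ‖A i j‖ * entryNorm A :=
          Finset.sum_le_sum fun i _ => Finset.sum_le_sum fun j _ => by
            rw [sq]
            exact mul_le_mul_of_nonneg_left (norm_apply_le_entryNorm A i j) (norm_nonneg _)
      _ = entryNorm A ^ 2 := by
          simp only [← Finset.sum_mul]; rw [sq]; rfl
  refine (Finset.sum_le_sum fun i _ => hA i).trans_eq (by simp)

theorem entryNorm_le_traceNorm (A : Op d) : entryNorm A ≤ d * d * traceNorm A := by
  have key : ∑ i, ∑ j, ‖A i j‖ ^ 2 ≤ traceNorm A ^ 2 := by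
    rw [← sum_eigenvalues_conjTranspose_mul_self, traceNorm]
    refine le_trans (Finset.sum_le_sum fun i _ => ?_)
      (Finset.sum_sq_le_sq_sum_of_nonneg fun i _ => Real.sqrt_nonneg _)
    rw [Real.sq_sqrt (eigenvalues_conjTranspose_mul_self_nonneg A i)]
  have hA : ∀ i j, ‖A i j‖ ≤ traceNorm A := by
    intro i j
    refine abs_le_of_sq_le_sq' (a := ‖A i j‖) (le_trans ?_ key) (traceNorm_nonneg A) |>.2
    exact (Finset.single_le_sum (f := fun j => ‖A i j‖ ^ 2) (fun _ _ => by positivity)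
      (Finset.mem_univ j)).trans
      (Finset.single_le_sum (f := fun i => ∑ j, ‖A i j‖ ^ 2) (fun _ _ => by positivity)
        (Finset.mem_univ i))
  refine (Finset.sum_le_sum fun i _ => Finset.sum_le_sum fun j _ => hA i j).trans_eq ?_
  simp [mul_assoc]

/-! ### The spanning hypothesis and uniform couplings -/

/-- Multiplication by `i` makes a Hermitian operator anti-Hermitian, so both parts of any operator
lie in the complex span. -/
theorem span_eq_top_of_antiHermitian_subset {V : Submodule ℂ (Op d)}
    (hV : {X : Op d | X = -X.conjTranspose} ⊆ (V : Set (Op d))) : V = ⊤ := by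
  refine eq_top_iff.mpr fun A _ => ?_
  have h1 : A - A.conjTranspose ∈ V := hV (by simp)
  have h2 : Complex.I • (A + A.conjTranspose) ∈ V := hV (by
    simp only [Set.mem_ofPred_eq, Matrix.conjTranspose_smul, Matrix.conjTranspose_add,
      Matrix.conjTranspose_conjTranspose]
    simp [add_comm])
  have h3 := V.add_mem (V.smul_mem (1 / 2 : ℂ) h1) (V.smul_mem (-Complex.I / 2) h2)
  convert h3 using 1
  have : (-Complex.I / 2) * Complex.I = 1 / 2 := by
    linear_combination (-1 / 2 : ℂ) * Complex.I_mul_I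
  rw [smul_smul, this, ← smul_add]
  ext i j
  simp only [Matrix.smul_apply, Matrix.add_apply, Matrix.sub_apply, smul_eq_mul]
  ring

theorem trace_mul_mul_mul_conjTranspose_diagonal (p q : Fin d → ℝ) (M : Op d) :
    ((Matrix.diagonal (fun l => (p l : ℂ)) * M * Matrix.diagonal (fun k => (q k : ℂ)) *
      M.conjTranspose).trace).re = ∑ l, ∑ k, p l * q k * ‖M l k‖ ^ 2 := by
  rw [Matrix.trace, Complex.re_sum]
  refine Finset.sum_congr rfl fun l _ => ?_
  rw [Matrix.diag_apply, Matrix.mul_apply, Complex.re_sum]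
  refine Finset.sum_congr rfl fun k _ => ?_
  rw [Matrix.mul_diagonal, Matrix.diagonal_mul, Matrix.conjTranspose_apply]
  have : (p l : ℂ) * M l k * q k * star (M l k) = ((p l * q k * ‖M l k‖ ^ 2 : ℝ) : ℂ) := by
    push_cast
    rw [← Complex.mul_conj']
    simp only [Complex.star_def]; ring
  rw [this, Complex.ofReal_re]

/-- If the jump operators and their adjoints span, then any two vectors of an orthonormal basis are
coupled by some jump operator, uniformly in the basis. -/
theorem exists_pos_le_sum_norm_apply (L : Fin m → Op d)
    (hspan : Submodule.span ℂ (Set.range L ∪ Set.range (fun j => (L j).conjTranspose)) = ⊤) :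
    ∃ c : ℝ, 0 < c ∧ ∀ U : Op d, U.conjTranspose * U = 1 → ∀ k l,
      c ≤ ∑ j, (‖(U.conjTranspose * L j * U) l k‖ ^ 2 +
        ‖(U.conjTranspose * L j * U) k l‖ ^ 2) := by
  set v : Fin m ⊕ Fin m → Op d := Sum.elim L (fun j => (L j).conjTranspose) with hv
  have hv' : Submodule.span ℂ (Set.range v) = ⊤ := by rw [hv, Set.Sum.elim_range, hspan]
  have hex : ∀ a b : Fin d, ∃ α : Fin m ⊕ Fin m → ℂ, ∑ x, α x • v x = Matrix.single a b 1 := by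
    intro a b
    exact (Submodule.mem_span_range_iff_exists_fun ℂ).mp (by rw [hv']; trivial)
  choose α hα using hex
  set B : ℝ := ∑ a, ∑ b, ∑ x, ‖α a b x‖ ^ 2 with hB
  have hB0 : 0 ≤ B := by positivity
  -- `B` collects the squared coefficients expressing all matrix units in the spanning family; the
  -- `+ 1` keeps the denominator positive when `d = 0`.
  refine ⟨1 / (B + 1), by positivity, fun U hU k l => ?_⟩
  set S : ℝ := ∑ j, (‖(U.conjTranspose * L j * U) l k‖ ^ 2 +
        ‖(U.conjTranspose * L j * U) k l‖ ^ 2) with hS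
  have hS0 : 0 ≤ S := by positivity
  have hSv : S = ∑ x, ‖(U.conjTranspose * v x * U) l k‖ ^ 2 := by
    rw [Fintype.sum_sum_type, hS, Finset.sum_add_distrib]
    congr 1
    refine Finset.sum_congr rfl fun j _ => ?_
    have : U.conjTranspose * v (Sum.inr j) * U =
        (U.conjTranspose * L j * U).conjTranspose := by
      simp [hv, Matrix.conjTranspose_mul, mul_assoc]
    rw [this, Matrix.conjTranspose_apply, norm_star]
  -- Evaluate the `(l, k)` entry of the rotated matrix unit in two ways and apply Cauchy–Schwarz.
  -- Summing over `a` and `b` then uses that the columns of `U` are unit vectors.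
  have hcs : ∀ a b, ‖U a l‖ ^ 2 * ‖U b k‖ ^ 2 ≤ (∑ x, ‖α a b x‖ ^ 2) * S := by
    intro a b
    have h1 : (U.conjTranspose * Matrix.single a b (1 : ℂ) * U) l k = star (U a l) * U b k := by
      simp [Matrix.mul_apply, Matrix.single_apply, Finset.sum_ite_eq, ite_and,
        Matrix.conjTranspose_apply]
    have h2 : (U.conjTranspose * Matrix.single a b (1 : ℂ) * U) l k =
        ∑ x, α a b x * (U.conjTranspose * v x * U) l k := by
      rw [← hα a b, Finset.mul_sum, Finset.sum_mul, Matrix.sum_apply]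
      simp
    have h3 : ‖U a l‖ * ‖U b k‖ ≤ ∑ x, ‖α a b x‖ * ‖(U.conjTranspose * v x * U) l k‖ := by
      have h4 : ‖U a l‖ * ‖U b k‖ = ‖star (U a l) * U b k‖ := by rw [norm_mul, norm_star]
      rw [h4, ← h1, h2]
      exact (norm_sum_le _ _).trans_eq (by simp)
    rw [← mul_pow, hSv]
    exact (pow_le_pow_left₀ (by positivity) h3 2).trans (Finset.sum_mul_sq_le_sq_mul_sq _ _ _)
  have hcol : ∀ l, ∑ a, ‖U a l‖ ^ 2 = 1 := by
    intro l
    have h := congrFun (congrFun hU l) l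
    rw [Matrix.mul_apply, Matrix.one_apply_eq] at h
    simp only [Matrix.conjTranspose_apply, Complex.star_def, Complex.conj_mul'] at h
    exact_mod_cast h
  have h5 : 1 ≤ B * S := by
    calc (1 : ℝ) = (∑ a, ‖U a l‖ ^ 2) * ∑ b, ‖U b k‖ ^ 2 := by rw [hcol, hcol, one_mul]
      _ = ∑ a, ∑ b, ‖U a l‖ ^ 2 * ‖U b k‖ ^ 2 := Finset.sum_mul_sum _ _ _ _
      _ ≤ ∑ a, ∑ b, (∑ x, ‖α a b x‖ ^ 2) * S :=
          Finset.sum_le_sum fun a _ => Finset.sum_le_sum fun b _ => hcs a b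
      _ = B * S := by rw [hB]; simp only [Finset.sum_mul]
  rw [div_le_iff₀ (by positivity)]
  nlinarith

/-! ### Trace and Hermiticity under the generator -/

theorem trace_jumpDissipator (L ρ : Op d) : (jumpDissipator L ρ).trace = 0 := by
  have h1 : (L * ρ * L.conjTranspose).trace = (L.conjTranspose * L * ρ).trace := by
    rw [Matrix.trace_mul_comm, mul_assoc]
  have h2 : (ρ * (L.conjTranspose * L)).trace = (L.conjTranspose * L * ρ).trace :=
    Matrix.trace_mul_comm _ _
  simp only [jumpDissipator, LinearMap.coe_mk, AddHom.coe_mk, Matrix.trace_sub,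
    Matrix.trace_smul, Matrix.trace_add, h1, h2, smul_eq_mul]
  ring

theorem trace_dissipator (L : Fin m → Op d) (ρ : Op d) : (dissipator L ρ).trace = 0 := by
  simp [dissipator, Matrix.trace_sum, trace_jumpDissipator]

theorem trace_drivenLindbladian (H : ℝ → Op d) (L : Fin m → Op d) (t : ℝ) (ρ : Op d) :
    (drivenLindbladian H (dissipator L) t ρ).trace = 0 := by
  simp [drivenLindbladian, hamiltonianPart, trace_dissipator, Matrix.trace_mul_comm ρ]

theorem isHermitian_jumpDissipator (L : Op d) {ρ : Op d} (hρ : ρ.IsHermitian) :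
    (jumpDissipator L ρ).IsHermitian := by
  simp [Matrix.IsHermitian, jumpDissipator, Matrix.conjTranspose_mul, hρ.eq, mul_assoc, add_comm]

theorem isHermitian_dissipator (L : Fin m → Op d) {ρ : Op d} (hρ : ρ.IsHermitian) :
    (dissipator L ρ).IsHermitian := by
  rw [dissipator, LinearMap.sum_apply, Matrix.IsHermitian, Matrix.conjTranspose_sum]
  exact Finset.sum_congr rfl fun j _ => isHermitian_jumpDissipator (L j) hρ

theorem isHermitian_hamiltonianPart {H ρ : Op d} (hH : H.IsHermitian) (hρ : ρ.IsHermitian) :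
    (hamiltonianPart H ρ).IsHermitian := by
  simp only [Matrix.IsHermitian, hamiltonianPart, LinearMap.coe_mk, AddHom.coe_mk,
    Matrix.conjTranspose_smul, Matrix.conjTranspose_sub, Matrix.conjTranspose_mul, hρ.eq, hH.eq,
    Complex.star_def, Complex.conj_I, neg_smul, ← smul_neg, neg_sub]

theorem isHermitian_drivenLindbladian {H : ℝ → Op d} {t : ℝ} (hH : (H t).IsHermitian)
    (L : Fin m → Op d) {ρ : Op d} (hρ : ρ.IsHermitian) :
    (drivenLindbladian H (dissipator L) t ρ).IsHermitian :=
  (isHermitian_hamiltonianPart hH hρ).add (isHermitian_dissipator L hρ)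

/-! ### Dissipation of the negative part -/

/-- By cyclicity `tr (P [H, ρ]) = tr (H [ρ, P])`. This is what makes the decay rate independent of
the Hamiltonian. -/
theorem trace_mul_hamiltonianPart_of_commute {P ρ : Op d} (H : Op d) (h : P * ρ = ρ * P) :
    (P * hamiltonianPart H ρ).trace = 0 := by
  have h1 : (P * (H * ρ)).trace = (P * (ρ * H)).trace := by
    rw [← mul_assoc P ρ, h, ← mul_assoc, Matrix.trace_mul_comm, mul_assoc]
  simp [hamiltonianPart, mul_sub, Matrix.trace_sub, h1]

theorem trace_mul_jumpDissipator_of_commute {P ρ : Op d} (L : Op d) (h : P * ρ = ρ * P) :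
    (P * jumpDissipator L ρ).trace =
      (P * L * ρ * L.conjTranspose).trace - (L * (P * ρ) * L.conjTranspose).trace := by
  have h1 : (P * (L.conjTranspose * L * ρ)).trace = (L * (P * ρ) * L.conjTranspose).trace := by
    rw [Matrix.trace_mul_comm, mul_assoc _ ρ, ← h, Matrix.trace_mul_comm (L * (P * ρ))]
    simp only [mul_assoc]
  have h2 : (P * (ρ * (L.conjTranspose * L))).trace = (L * (P * ρ) * L.conjTranspose).trace := by
    rw [← mul_assoc P, ← mul_assoc, Matrix.trace_mul_comm]
    simp only [mul_assoc]
  simp only [jumpDissipator, LinearMap.coe_mk, AddHom.coe_mk, mul_sub, mul_add, mul_smul_comm,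
    Matrix.trace_sub, Matrix.trace_smul, Matrix.trace_add, h1, h2, smul_eq_mul]
  simp only [← mul_assoc]
  ring

theorem trace_mul_conj_diagonal (P U : Op d) (ev : Fin d → ℝ) :
    (P * (U * Matrix.diagonal (fun k => (ev k : ℂ)) * U.conjTranspose)).trace.re =
      ∑ k, ((U.conjTranspose * P * U) k k).re * ev k := by
  have : (P * (U * Matrix.diagonal (fun k => (ev k : ℂ)) * U.conjTranspose)).trace =
      (U.conjTranspose * P * U * Matrix.diagonal (fun k => (ev k : ℂ))).trace := by
    rw [← mul_assoc, Matrix.trace_mul_comm]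
    simp only [mul_assoc]
  rw [this, Matrix.trace, Complex.re_sum]
  refine Finset.sum_congr rfl fun k _ => ?_
  rw [Matrix.diag_apply, Matrix.mul_diagonal, Complex.re_mul_ofReal]

theorem isStarProjection_conjTranspose_mul_mul {P U : Op d} (hP : IsStarProjection P)
    (hU : U * U.conjTranspose = 1) : IsStarProjection (U.conjTranspose * P * U) := by
  have h1 : P * P = P := hP.isIdempotentElem
  have h2 : P.conjTranspose = P := hP.isSelfAdjoint
  refine ⟨?_, ?_⟩
  · change U.conjTranspose * P * U * (U.conjTranspose * P * U) = _
    calc _ = U.conjTranspose * P * (U * U.conjTranspose) * P * U := by simp only [mul_assoc]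
      _ = _ := by rw [hU, mul_one, mul_assoc _ P P, h1]
  · change (U.conjTranspose * P * U).conjTranspose = _
    simp [Matrix.conjTranspose_mul, h2, mul_assoc]

theorem isStarProjection_mul_mul_conjTranspose {P U : Op d} (hP : IsStarProjection P)
    (hU : U.conjTranspose * U = 1) : IsStarProjection (U * P * U.conjTranspose) := by
  have := isStarProjection_conjTranspose_mul_mul (U := U.conjTranspose) hP (by simpa using hU)
  simpa using this

theorem entryNorm_conj_diagonal_le {U : Op d} (hU : ∀ i j, ‖U i j‖ ≤ 1) (ev : Fin d → ℝ) :
    entryNorm (U * Matrix.diagonal (fun k => (ev k : ℂ)) * U.conjTranspose) ≤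
      d * d * ∑ k, |ev k| := by
  have h : ∀ i j, ‖(U * Matrix.diagonal (fun k => (ev k : ℂ)) * U.conjTranspose) i j‖ ≤
      ∑ k, |ev k| := by
    intro i j
    rw [Matrix.mul_apply]
    refine (norm_sum_le _ _).trans (Finset.sum_le_sum fun k _ => ?_)
    rw [Matrix.mul_diagonal, Matrix.conjTranspose_apply, norm_mul, norm_mul, norm_star,
      Complex.norm_real, Real.norm_eq_abs]
    have h1 := hU i k
    have h2 := hU j k
    calc ‖U i k‖ * |ev k| * ‖U j k‖ ≤ 1 * |ev k| * 1 := by gcongr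
      _ = |ev k| := by ring
  refine (Finset.sum_le_sum fun i _ => Finset.sum_le_sum fun j _ => h i j).trans_eq ?_
  simp [mul_assoc]

/-- In a common eigenbasis the dissipator reduces to a classical master equation: weight `ev k`
jumps from `k` to `l` at rate `|⟨l|L|k⟩|²`, changing the observable by `p l - p k`. -/
theorem trace_conj_mul_jumpDissipator_conj {U : Op d} (hU : U.conjTranspose * U = 1)
    (L : Op d) (p ev : Fin d → ℝ) :
    ((U * Matrix.diagonal (fun k => (p k : ℂ)) * U.conjTranspose) *
      jumpDissipator L (U * Matrix.diagonal (fun k => (ev k : ℂ)) * U.conjTranspose)).trace.re =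
    ∑ l, ∑ k, (p l - p k) * ev k * ‖(U.conjTranspose * L * U) l k‖ ^ 2 := by
  set P := Matrix.diagonal (fun k => (p k : ℂ)) with hP
  set E := Matrix.diagonal (fun k => (ev k : ℂ)) with hE
  have hmul : ∀ A B : Op d, U * A * U.conjTranspose * (U * B * U.conjTranspose) =
      U * (A * B) * U.conjTranspose := by
    intro A B
    calc _ = U * A * (U.conjTranspose * U) * B * U.conjTranspose := by simp only [mul_assoc]
      _ = _ := by rw [hU, mul_one]; simp only [mul_assoc]
  have hPE : P * E = Matrix.diagonal (fun k => ((p k * ev k : ℝ) : ℂ)) := by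
    rw [hP, hE, Matrix.diagonal_mul_diagonal]; simp
  have hEP : E * P = P * E := by
    rw [hP, hE, Matrix.diagonal_mul_diagonal, Matrix.diagonal_mul_diagonal]; simp [mul_comm]
  rw [trace_mul_jumpDissipator_of_commute _ (by rw [hmul, hmul, hEP]), hmul, Complex.sub_re]
  have h1 : (U * P * U.conjTranspose * L * (U * E * U.conjTranspose) * L.conjTranspose).trace =
      (P * (U.conjTranspose * L * U) * E * (U.conjTranspose * L * U).conjTranspose).trace := by
    simp only [Matrix.conjTranspose_mul, Matrix.conjTranspose_conjTranspose, mul_assoc]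
    rw [Matrix.trace_mul_comm U]
    simp only [mul_assoc]
  have h2 : (L * (U * (P * E) * U.conjTranspose) * L.conjTranspose).trace =
      (Matrix.diagonal (fun _ => ((1 : ℝ) : ℂ)) * (U.conjTranspose * L * U) * (P * E) *
        (U.conjTranspose * L * U).conjTranspose).trace := by
    have h3 : Matrix.diagonal (fun _ : Fin d => ((1 : ℝ) : ℂ)) = 1 := by simp
    have h4 : U * U.conjTranspose = 1 := mul_eq_one_comm.mp hU
    rw [h3, one_mul]
    simp only [Matrix.conjTranspose_mul, Matrix.conjTranspose_conjTranspose, mul_assoc]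
    rw [Matrix.trace_mul_comm U.conjTranspose]
    simp only [mul_assoc, h4, mul_one]
  rw [h1, h2, hPE, trace_mul_mul_mul_conjTranspose_diagonal,
    trace_mul_mul_mul_conjTranspose_diagonal, ← Finset.sum_sub_distrib]
  refine Finset.sum_congr rfl fun l _ => ?_
  rw [← Finset.sum_sub_distrib]
  refine Finset.sum_congr rfl fun k _ => ?_
  ring

/-- The transfer of weight between the negative and the nonnegative part of a spectrum with sum
zero, for couplings whose symmetrization is bounded below. -/
theorem sum_neg_part_le_sum_transfer {ev : Fin d → ℝ} (hev : ∑ k, ev k = 0)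
    {w : Fin d → Fin d → ℝ} (hw : ∀ l k, 0 ≤ w l k) {c : ℝ}
    (hc : ∀ l k, c ≤ w l k + w k l) :
    c / (d + 1) * ∑ k, max (-ev k) 0 ≤
      ∑ l, ∑ k, ((if ev l < 0 then 1 else 0) - (if ev k < 0 then 1 else 0)) * ev k * w l k := by
  set n := ∑ k, max (-ev k) 0 with hn
  set f : Fin d → Fin d → ℝ := fun l k =>
    ((if ev l < 0 then 1 else 0) - (if ev k < 0 then 1 else 0)) * ev k * w l k with hf
  have hf0 : ∀ l k, 0 ≤ f l k := by
    intro l k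
    refine mul_nonneg ?_ (hw l k)
    split_ifs <;> simp <;> linarith
  have hn0 : 0 ≤ n := Finset.sum_nonneg fun _ _ => le_max_right _ _
  have hsum0 : 0 ≤ ∑ l, ∑ k, f l k :=
    Finset.sum_nonneg fun l _ => Finset.sum_nonneg fun k _ => hf0 l k
  rcases hn0.eq_or_lt with h0 | hpos
  · rw [← h0, mul_zero]; exact hsum0
  have hn' : n = ∑ k, max (ev k) 0 := by
    have : ∑ k, max (ev k) 0 - n = ∑ k, ev k := by
      rw [hn, ← Finset.sum_sub_distrib]
      refine Finset.sum_congr rfl fun k _ => ?_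
      rcases le_total (ev k) 0 with h | h
      · rw [max_eq_right h, max_eq_left (by linarith)]; ring
      · rw [max_eq_left h, max_eq_right (by linarith)]; ring
    linarith
  have hd : (0 : ℝ) < d + 1 := by positivity
  -- Dividing by `d + 1` rather than `d` makes the pigeonhole strict.
  have hlt : (∑ _k : Fin d, n / (d + 1)) < n := by
    simp only [Finset.sum_const, Finset.card_univ, Fintype.card_fin, nsmul_eq_mul]
    rw [mul_div_assoc', div_lt_iff₀ hd]
    nlinarith
  have hδ : 0 < n / (d + 1) := by positivity
  obtain ⟨a, -, ha⟩ := Finset.exists_lt_of_sum_lt (hlt.trans_eq hn)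
  obtain ⟨b, -, hb⟩ := Finset.exists_lt_of_sum_lt (hlt.trans_eq hn')
  have ha' : n / (d + 1) < -ev a := by
    rcases lt_max_iff.mp ha with h | h
    · exact h
    · linarith
  have hb' : n / (d + 1) < ev b := by
    rcases lt_max_iff.mp hb with h | h
    · exact h
    · linarith
  have hea : ev a < 0 := by linarith
  have heb : ¬ ev b < 0 := by linarith
  have hab : a ≠ b := fun h => heb (h ▸ hea)
  -- Both directions are kept, since only the sum `w a b + w b a` is bounded below.
  have h1 : f a b + f b a ≤ ∑ l, ∑ k, f l k := by
    have h2 : ∀ l k, f l k ≤ ∑ k, f l k := fun l k =>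
      Finset.single_le_sum (fun k _ => hf0 l k) (Finset.mem_univ k)
    calc f a b + f b a ≤ ∑ k, f a k + ∑ k, f b k := add_le_add (h2 a b) (h2 b a)
      _ = ∑ l ∈ {a, b}, ∑ k, f l k := (Finset.sum_pair (f := fun l => ∑ k, f l k) hab).symm
      _ ≤ _ := Finset.sum_le_sum_of_subset_of_nonneg (Finset.subset_univ _)
          fun l _ _ => Finset.sum_nonneg fun k _ => hf0 l k
  refine le_trans ?_ h1
  have hfab : f a b = ev b * w a b := by simp [hf, hea, heb]
  have hfba : f b a = -ev a * w b a := by simp [hf, hea, heb]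
  rw [hfab, hfba]
  have h3 := mul_le_mul_of_nonneg_right hb'.le (hw a b)
  have h4 := mul_le_mul_of_nonneg_right ha'.le (hw b a)
  have h5 := mul_le_mul_of_nonneg_left (hc a b) hδ.le
  have h6 : c / (d + 1) * n = n / (d + 1) * c := by ring
  rw [h6]
  linarith

/-- The negative spectral projection of a traceless Hermitian operator, with the properties that
make the negative part of the spectrum a Lyapunov function. -/
theorem exists_negative_projection (L : Fin m → Op d)
    (hspan : Submodule.span ℂ (Set.range L ∪ Set.range (fun j => (L j).conjTranspose)) = ⊤) :
    ∃ κ : ℝ, 0 < κ ∧ ∀ Y : Op d, Y.IsHermitian → Y.trace = 0 →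
      ∃ P : Op d, IsStarProjection P ∧ P * Y = Y * P ∧
        (∀ Q : Op d, IsStarProjection Q → -(Q * Y).trace.re ≤ -(P * Y).trace.re) ∧
        κ * -(P * Y).trace.re ≤ (P * dissipator L Y).trace.re ∧
        entryNorm Y ≤ 2 * d * d * -(P * Y).trace.re := by
  obtain ⟨c, hc, hcU⟩ := exists_pos_le_sum_norm_apply L hspan
  refine ⟨c / (d + 1), by positivity, fun Y hY hY0 => ?_⟩
  set U : Op d := (hY.eigenvectorUnitary : Op d) with hUdef
  set ev : Fin d → ℝ := hY.eigenvalues with hev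
  have hU1 : U.conjTranspose * U = 1 := Unitary.coe_star_mul_self hY.eigenvectorUnitary
  have hU2 : U * U.conjTranspose = 1 := Unitary.coe_mul_star_self hY.eigenvectorUnitary
  have hYU : Y = U * Matrix.diagonal (fun k => (ev k : ℂ)) * U.conjTranspose := by
    have := hY.spectral_theorem
    rw [Unitary.conjStarAlgAut_apply] at this
    exact this
  have hsum : ∑ k, ev k = 0 := by
    have h := hY.trace_eq_sum_eigenvalues
    rw [hY0] at h
    have h3 := congrArg Complex.re h
    rw [Complex.re_sum] at h3
    exact h3.symm
  set p : Fin d → ℝ := fun k => if ev k < 0 then 1 else 0 with hp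
  have hpp : IsStarProjection (Matrix.diagonal (fun k => (p k : ℂ))) := by
    refine ⟨?_, ?_⟩
    · change Matrix.diagonal _ * Matrix.diagonal _ = _
      rw [Matrix.diagonal_mul_diagonal]
      congr 1; ext k; simp only [hp]; split_ifs <;> simp
    · change Matrix.conjTranspose _ = _
      rw [Matrix.diagonal_conjTranspose]
      congr 1; ext k; simp
  set P : Op d := U * Matrix.diagonal (fun k => (p k : ℂ)) * U.conjTranspose with hP
  have hPproj : IsStarProjection P := isStarProjection_mul_mul_conjTranspose hpp hU1
  have hUPU : U.conjTranspose * P * U = Matrix.diagonal (fun k => (p k : ℂ)) := by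
    rw [hP]
    calc _ = (U.conjTranspose * U) * Matrix.diagonal (fun k => (p k : ℂ)) *
          (U.conjTranspose * U) := by simp only [mul_assoc]
      _ = _ := by rw [hU1, mul_one, one_mul]
  have hn : -(P * Y).trace.re = ∑ k, max (-ev k) 0 := by
    rw [hYU, trace_mul_conj_diagonal, hUPU, ← Finset.sum_neg_distrib]
    refine Finset.sum_congr rfl fun k _ => ?_
    rw [Matrix.diagonal_apply_eq, Complex.ofReal_re]
    simp only [hp]
    split_ifs with h
    · rw [max_eq_left (by linarith)]; ring
    · rw [max_eq_right (by linarith)]; ring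
  refine ⟨P, hPproj, ?_, fun Q hQ => ?_, ?_, ?_⟩
  · have hmul : ∀ A B : Op d, U * A * U.conjTranspose * (U * B * U.conjTranspose) =
        U * (A * B) * U.conjTranspose := by
      intro A B
      calc _ = U * A * (U.conjTranspose * U) * B * U.conjTranspose := by simp only [mul_assoc]
        _ = _ := by rw [hU1, mul_one]; simp only [mul_assoc]
    rw [hYU, hP, hmul, hmul, Matrix.diagonal_mul_diagonal, Matrix.diagonal_mul_diagonal]
    simp only [mul_comm]
  -- Maximum principle: in the eigenbasis of `Y` the diagonal entries of `Q` lie in `[0, 1]`.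
  · rw [hn, hYU, trace_mul_conj_diagonal, ← Finset.sum_neg_distrib]
    refine Finset.sum_le_sum fun k _ => ?_
    have hQ' := isStarProjection_conjTranspose_mul_mul hQ hU2
    have h1 := diag_nonneg_of_isStarProjection hQ' k
    have h2 := diag_le_one_of_isStarProjection hQ' k
    rcases le_total (ev k) 0 with h | h
    · refine le_trans ?_ (le_max_left _ _)
      nlinarith
    · refine le_trans ?_ (le_max_right _ _)
      nlinarith
  · rw [hn, dissipator, LinearMap.sum_apply, Finset.mul_sum (s := Finset.univ (α := Fin m)),
      Matrix.trace_sum, Complex.re_sum]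
    have h1 : ∀ j, (P * jumpDissipator (L j) Y).trace.re =
        ∑ l, ∑ k, (p l - p k) * ev k * ‖(U.conjTranspose * L j * U) l k‖ ^ 2 := by
      intro j
      rw [hP]
      conv_lhs => rw [hYU]
      exact trace_conj_mul_jumpDissipator_conj hU1 (L j) p ev
    have h2 := sum_neg_part_le_sum_transfer hsum
      (w := fun l k => ∑ j, ‖(U.conjTranspose * L j * U) l k‖ ^ 2) (fun _ _ => by positivity)
      (fun l k => by rw [← Finset.sum_add_distrib]; exact hcU U hU1 k l)
    refine h2.trans_eq ?_
    simp only [h1, Finset.mul_sum]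
    symm
    rw [Finset.sum_comm]
    refine Finset.sum_congr rfl fun l _ => ?_
    rw [Finset.sum_comm]
  -- Zero trace balances the positive and negative parts of the spectrum.
  · have h1 : ∑ k, |ev k| = 2 * ∑ k, max (-ev k) 0 := by
      have : ∑ k, |ev k| = ∑ k, (ev k + 2 * max (-ev k) 0) := by
        refine Finset.sum_congr rfl fun k _ => ?_
        rcases le_total (ev k) 0 with h | h
        · rw [abs_of_nonpos h, max_eq_left (by linarith)]; ring
        · rw [abs_of_nonneg h, max_eq_right (by linarith)]; ring
      rw [this, Finset.sum_add_distrib, hsum, zero_add, Finset.mul_sum]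
    rw [hn]
    conv_lhs => rw [hYU]
    refine (entryNorm_conj_diagonal_le
      (entry_norm_bound_of_unitary hY.eigenvectorUnitary.2) ev).trans_eq ?_
    rw [h1]; ring

/-! ### A left-local monotonicity criterion -/

open Filter Topology Set in
/-- A continuous function that does not increase over short intervals to the left of any point
does not increase. -/
theorem le_of_eventually_nhdsLT_le {g : ℝ → ℝ} {a b : ℝ} (hab : a ≤ b)
    (hg : ContinuousOn g (Icc a b))
    (h : ∀ t ∈ Ioc a b, ∀ᶠ r in 𝓝[<] t, a ≤ r → g t ≤ g r) : g b ≤ g a := by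
  -- The least point of this compact set must be `a`, as otherwise the local hypothesis yields a
  -- point of the set further left.
  set T : Set ℝ := Icc a b ∩ g ⁻¹' Ici (g b) with hT
  have hTc : IsCompact T :=
    isCompact_Icc.of_isClosed_subset (hg.preimage_isClosed_of_isClosed isClosed_Icc isClosed_Ici)
      inter_subset_left
  have hTn : T.Nonempty := ⟨b, right_mem_Icc.mpr hab, le_refl (g b)⟩
  obtain ⟨⟨ht1, ht2⟩, ht3⟩ := hTc.sInf_mem hTn
  set t := sInf T with ht
  rcases ht1.eq_or_lt with h0 | h0
  · rw [h0]; exact ht3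
  obtain ⟨r, hr, har, hrt⟩ := ((h t ⟨h0, ht2⟩).and (Ioo_mem_nhdsLT h0)).exists
  have hrT : r ∈ T := ⟨⟨har.le, hrt.le.trans ht2⟩, le_trans ht3 (hr har.le)⟩
  exact absurd (csInf_le hTc.bddBelow hrT) (not_le.mpr hrt)

/-! ### Locally integrable generators and the Dyson series -/

theorem intervalIntegrable_sum {ι E : Type*} [Fintype ι] [NormedAddCommGroup E] {a b : ℝ}
    {f : ι → ℝ → E} (h : ∀ i, IntervalIntegrable (f i) volume a b) :
    IntervalIntegrable (fun t => ∑ i, f i t) volume a b := by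
  simpa only [Finset.sum_fn] using IntervalIntegrable.sum Finset.univ fun i _ => h i

/-- A time-dependent superoperator with locally integrable coefficients, bounded by the locally
integrable function `ℓ`. -/
structure IsLocallyIntegrableFamily (𝓛 : ℝ → SuperOp d) (ℓ : ℝ → ℝ) : Prop where
  intervalIntegrable_apply : ∀ (y : ℝ → Op d) (a b : ℝ), ContinuousOn y (Set.uIcc a b) →
    ∀ i j, IntervalIntegrable (fun τ => 𝓛 τ (y τ) i j) volume a b
  intervalIntegrable_bound : ∀ a b, IntervalIntegrable ℓ volume a b
  bound_nonneg : ∀ τ, 0 ≤ ℓ τ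
  entryNorm_le : ∀ τ x, entryNorm (𝓛 τ x) ≤ ℓ τ * entryNorm x

theorem exists_isLocallyIntegrableFamily {H : ℝ → Op d} (hH : IsHamiltonian H) (D : SuperOp d) :
    ∃ ℓ, IsLocallyIntegrableFamily (drivenLindbladian H D) ℓ := by
  obtain ⟨C, hC, hD⟩ := exists_entryNorm_map_le D
  have hHint : ∀ a b i j, IntervalIntegrable (fun t => H t i j) volume a b := fun a b i j =>
    ((hH.locallyIntegrable i j).integrableOn_isCompact isCompact_uIcc).intervalIntegrable
  refine ⟨fun t => 2 * entryNorm (H t) + C, fun y a b hy i j => ?_, fun a b => ?_, fun τ => ?_,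
    fun τ x => ?_⟩
  · have hyij : ∀ i j, ContinuousOn (fun τ => y τ i j) (Set.uIcc a b) := fun i j =>
      (continuous_id.matrix_elem i j).comp_continuousOn hy
    have h1 : IntervalIntegrable (fun τ => ∑ k, H τ i k * y τ k j) volume a b :=
      intervalIntegrable_sum fun k => (hHint a b i k).mul_continuousOn (hyij k j)
    have h2 : IntervalIntegrable (fun τ => ∑ k, y τ i k * H τ k j) volume a b :=
      intervalIntegrable_sum fun k => (hHint a b k j).continuousOn_mul (hyij i k)
    have h3 : IntervalIntegrable (fun τ => D (y τ) i j) volume a b :=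
      (((LinearMap.continuous_of_finiteDimensional D).matrix_elem i j).comp_continuousOn
        hy).intervalIntegrable
    have h4 := ((h1.sub h2).const_mul (-Complex.I)).add h3
    refine h4.congr_ae (Filter.Eventually.of_forall fun τ => ?_)
    simp [drivenLindbladian, hamiltonianPart, Matrix.mul_apply]
  · refine ((intervalIntegrable_sum fun i => intervalIntegrable_sum fun j =>
      (hHint a b i j).norm).const_mul 2).add intervalIntegrable_const
  · have := entryNorm_nonneg (H τ)
    positivity
  · have h1 : entryNorm (hamiltonianPart (H τ) x) ≤ 2 * entryNorm (H τ) * entryNorm x := by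
      simp only [hamiltonianPart, LinearMap.coe_mk, AddHom.coe_mk, entryNorm_smul, norm_neg,
        Complex.norm_I, one_mul]
      have h2 := entryNorm_sub_le (H τ * x) (x * H τ)
      have h3 := entryNorm_mul_le (H τ) x
      have h4 := entryNorm_mul_le x (H τ)
      linarith
    have h2 := entryNorm_add_le (hamiltonianPart (H τ) x) (D x)
    have h3 := hD x
    simp only [drivenLindbladian, LinearMap.add_apply]
    linarith

namespace IsLocallyIntegrableFamily

variable {𝓛 : ℝ → SuperOp d} {ℓ : ℝ → ℝ}

theorem continuous_primitive (h : IsLocallyIntegrableFamily 𝓛 ℓ) (s : ℝ) :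
    Continuous fun t => ∫ τ in s..t, ℓ τ :=
  intervalIntegral.continuous_primitive h.intervalIntegrable_bound s

theorem primitive_sub (h : IsLocallyIntegrableFamily 𝓛 ℓ) (s r t : ℝ) :
    (∫ τ in s..t, ℓ τ) - ∫ τ in s..r, ℓ τ = ∫ τ in r..t, ℓ τ :=
  intervalIntegral.integral_interval_sub_left (h.intervalIntegrable_bound _ _)
    (h.intervalIntegrable_bound _ _)

theorem primitive_mono (h : IsLocallyIntegrableFamily 𝓛 ℓ) (s : ℝ) :
    Monotone fun t => ∫ τ in s..t, ℓ τ := by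
  intro r t hrt
  have h1 := h.primitive_sub s r t
  have h2 : 0 ≤ ∫ τ in r..t, ℓ τ :=
    intervalIntegral.integral_nonneg hrt fun τ _ => h.bound_nonneg τ
  change (∫ τ in s..r, ℓ τ) ≤ ∫ τ in s..t, ℓ τ
  linarith

theorem intervalIntegrable_mul_exp (h : IsLocallyIntegrableFamily 𝓛 ℓ) (s a b : ℝ) :
    IntervalIntegrable (fun τ => ℓ τ * Real.exp (4 * ∫ σ in s..τ, ℓ σ)) volume a b :=
  (h.intervalIntegrable_bound a b).mul_continuousOn
    (Real.continuous_exp.comp ((h.continuous_primitive s).const_mul 4)).continuousOn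

open Filter Topology in
-- Formally the integral is at most a quarter of the exponential. Settling for a half leaves a
-- factor `2` of room, which absorbs the variation of the exponential over a short interval and
-- avoids differentiating the primitive of `ℓ`.
theorem integral_mul_exp_le (h : IsLocallyIntegrableFamily 𝓛 ℓ) {s t : ℝ} (hst : s ≤ t) :
    ∫ τ in s..t, ℓ τ * Real.exp (4 * ∫ σ in s..τ, ℓ σ) ≤
      1 / 2 * Real.exp (4 * ∫ σ in s..t, ℓ σ) := by
  set G : ℝ → ℝ := fun t => ∫ σ in s..t, ℓ σ with hG
  have hGc : Continuous G := h.continuous_primitive s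
  have hGm : Monotone G := h.primitive_mono s
  have hEc : Continuous fun t => Real.exp (4 * G t) :=
    Real.continuous_exp.comp (hGc.const_mul 4)
  have hint := h.intervalIntegrable_mul_exp s
  have key := le_of_eventually_nhdsLT_le
    (g := fun t => (∫ τ in s..t, ℓ τ * Real.exp (4 * G τ)) - 1 / 2 * Real.exp (4 * G t)) hst
    ((intervalIntegral.continuous_primitive hint s).sub (hEc.const_mul _)).continuousOn ?_
  · simp only [intervalIntegral.integral_same] at key
    have := Real.exp_pos (4 * G s)
    change ∫ τ in s..t, ℓ τ * Real.exp (4 * G τ) ≤ 1 / 2 * Real.exp (4 * G t)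
    linarith
  · intro t _
    have h1 : ∀ᶠ r in 𝓝[<] t, Real.exp (4 * G t) < 2 * Real.exp (4 * G r) :=
      ((hEc.const_mul 2).continuousWithinAt.eventually_const_lt
        (by linarith [Real.exp_pos (4 * G t)]))
    filter_upwards [h1, self_mem_nhdsWithin] with r hr hrt _
    have hrt' : r ≤ t := le_of_lt hrt
    have h2 : (∫ τ in s..t, ℓ τ * Real.exp (4 * G τ)) -
        ∫ τ in s..r, ℓ τ * Real.exp (4 * G τ) = ∫ τ in r..t, ℓ τ * Real.exp (4 * G τ) :=
      intervalIntegral.integral_interval_sub_left (hint _ _) (hint _ _)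
    have h3 : ∫ τ in r..t, ℓ τ * Real.exp (4 * G τ) ≤
        ∫ τ in r..t, ℓ τ * Real.exp (4 * G t) := by
      refine intervalIntegral.integral_mono_on hrt' (hint _ _)
        ((h.intervalIntegrable_bound r t).mul_const _) fun τ hτ => ?_
      have := hGm hτ.2
      have := h.bound_nonneg τ
      gcongr
    rw [intervalIntegral.integral_mul_const, ← h.primitive_sub s r t] at h3
    change _ ≤ (G t - G r) * _ at h3
    have h4 := Real.add_one_le_exp (4 * G t - 4 * G r)
    have h5 : Real.exp (4 * G t) = Real.exp (4 * G r) * Real.exp (4 * G t - 4 * G r) := by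
      rw [← Real.exp_add]; congr 1; ring
    have h6 := mul_le_mul_of_nonneg_left h4 (Real.exp_pos (4 * G r)).le
    have h7 := mul_le_mul_of_nonneg_left hr.le (sub_nonneg.mpr (hGm hrt'))
    nlinarith

theorem continuous_dysonTerm (h : IsLocallyIntegrableFamily 𝓛 ℓ) (s : ℝ) (x : Op d) (n : ℕ) :
    Continuous (dysonTerm 𝓛 s x n) := by
  induction n with
  | zero => exact continuous_const
  | succ n ih =>
    refine continuous_pi fun i => continuous_pi fun j => ?_
    exact intervalIntegral.continuous_primitive
      (fun a b => h.intervalIntegrable_apply _ a b ih.continuousOn i j) s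

/-- Measured against the exponential weight, each time integration gains a factor `1 / 2`, so the
series is dominated by a geometric one. -/
theorem entryNorm_dysonTerm_le (h : IsLocallyIntegrableFamily 𝓛 ℓ) (s : ℝ) (x : Op d) (n : ℕ)
    {t : ℝ} (hst : s ≤ t) :
    entryNorm (dysonTerm 𝓛 s x n t) ≤
      entryNorm x * (1 / 2) ^ n * Real.exp (4 * ∫ σ in s..t, ℓ σ) := by
  have hx := entryNorm_nonneg x
  induction n generalizing t with
  | zero =>
    have h1 : 0 ≤ ∫ σ in s..t, ℓ σ :=
      intervalIntegral.integral_nonneg hst fun τ _ => h.bound_nonneg τ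
    have h2 : 1 ≤ Real.exp (4 * ∫ σ in s..t, ℓ σ) := Real.one_le_exp (by positivity)
    simp only [dysonTerm, pow_zero, mul_one]
    exact le_mul_of_one_le_right hx h2
  | succ n ih =>
    have hint : ∀ i j, IntervalIntegrable (fun τ => 𝓛 τ (dysonTerm 𝓛 s x n τ) i j) volume s t :=
      h.intervalIntegrable_apply _ s t (h.continuous_dysonTerm s x n).continuousOn
    have hint' : ∀ i, IntervalIntegrable
        (fun τ => ∑ j, ‖𝓛 τ (dysonTerm 𝓛 s x n τ) i j‖) volume s t := fun i =>
      intervalIntegrable_sum fun j => (hint i j).norm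
    calc entryNorm (dysonTerm 𝓛 s x (n + 1) t)
        ≤ ∑ i, ∑ j, ∫ τ in s..t, ‖𝓛 τ (dysonTerm 𝓛 s x n τ) i j‖ :=
          Finset.sum_le_sum fun i _ => Finset.sum_le_sum fun j _ =>
            intervalIntegral.norm_integral_le_integral_norm hst
      _ = ∫ τ in s..t, entryNorm (𝓛 τ (dysonTerm 𝓛 s x n τ)) := by
          simp only [entryNorm]
          rw [intervalIntegral.integral_finsetSum fun i _ => hint' i]
          refine Finset.sum_congr rfl fun i _ => ?_
          rw [intervalIntegral.integral_finsetSum fun j _ => (hint i j).norm]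
      _ ≤ ∫ τ in s..t, (ℓ τ * Real.exp (4 * ∫ σ in s..τ, ℓ σ)) *
            (entryNorm x * (1 / 2) ^ n) := by
          refine intervalIntegral.integral_mono_on hst
            (intervalIntegrable_sum fun i => hint' i)
            ((h.intervalIntegrable_mul_exp s s t).mul_const _) fun τ hτ => ?_
          refine (h.entryNorm_le τ _).trans ?_
          have := mul_le_mul_of_nonneg_left (ih hτ.1) (h.bound_nonneg τ)
          linarith
      _ ≤ 1 / 2 * Real.exp (4 * ∫ σ in s..t, ℓ σ) * (entryNorm x * (1 / 2) ^ n) := by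
          rw [intervalIntegral.integral_mul_const]
          exact mul_le_mul_of_nonneg_right (h.integral_mul_exp_le hst) (by positivity)
      _ = _ := by ring

theorem norm_dysonTerm_apply_le (h : IsLocallyIntegrableFamily 𝓛 ℓ) {s : ℝ} (x : Op d) (n : ℕ)
    {t T : ℝ} (ht : t ∈ Set.Icc s T) (i j : Fin d) :
    ‖dysonTerm 𝓛 s x n t i j‖ ≤
      entryNorm x * (1 / 2) ^ n * Real.exp (4 * ∫ σ in s..T, ℓ σ) := by
  refine (norm_apply_le_entryNorm _ i j).trans ((h.entryNorm_dysonTerm_le s x n ht.1).trans ?_)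
  have h1 := h.primitive_mono s ht.2
  have h2 := entryNorm_nonneg x
  simp only at h1
  gcongr

theorem summable_bound (C E : ℝ) : Summable fun n : ℕ => C * (1 / 2) ^ n * E :=
  (summable_geometric_two.mul_left C).mul_right E

theorem hasSum_dysonTerm (h : IsLocallyIntegrableFamily 𝓛 ℓ) {s t : ℝ} (hst : s ≤ t) (x : Op d) :
    HasSum (fun n => dysonTerm 𝓛 s x n t) (timeEvolution 𝓛 t s x) := by
  refine Summable.hasSum (Pi.summable.mpr fun i => Pi.summable.mpr fun j => ?_)
  exact Summable.of_norm_bounded (summable_bound _ _)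
    fun n => h.norm_dysonTerm_apply_le x n (Set.right_mem_Icc.mpr hst) i j

theorem hasSum_dysonTerm_apply (h : IsLocallyIntegrableFamily 𝓛 ℓ) {s t : ℝ} (hst : s ≤ t)
    (x : Op d) (i j : Fin d) :
    HasSum (fun n => dysonTerm 𝓛 s x n t i j) (timeEvolution 𝓛 t s x i j) :=
  Pi.hasSum.mp (Pi.hasSum.mp (h.hasSum_dysonTerm hst x) i) j

theorem continuousOn_timeEvolution (h : IsLocallyIntegrableFamily 𝓛 ℓ) (s T : ℝ) (x : Op d) :
    ContinuousOn (fun t => timeEvolution 𝓛 t s x) (Set.Icc s T) := by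
  refine continuousOn_pi.mpr fun i => continuousOn_pi.mpr fun j => ?_
  have h1 : ContinuousOn (fun t => ∑' n, dysonTerm 𝓛 s x n t i j) (Set.Icc s T) :=
    continuousOn_tsum (fun n => ((h.continuous_dysonTerm s x n).matrix_elem i j).continuousOn)
      (summable_bound _ _) fun n t ht => h.norm_dysonTerm_apply_le x n ht i j
  exact h1.congr fun t ht => (h.hasSum_dysonTerm_apply ht.1 x i j).tsum_eq.symm

theorem intervalIntegrable_timeEvolution (h : IsLocallyIntegrableFamily 𝓛 ℓ) (x : Op d)
    {s a b : ℝ} (ha : s ≤ a) (hb : s ≤ b) (i j : Fin d) :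
    IntervalIntegrable (fun τ => 𝓛 τ (timeEvolution 𝓛 τ s x) i j) volume a b :=
  h.intervalIntegrable_apply _ a b
    ((h.continuousOn_timeEvolution s (max a b) x).mono
      (Set.Icc_subset_Icc_left (le_min ha hb))) i j

/-- The integral form of the evolution equation. -/
theorem timeEvolution_apply_eq (h : IsLocallyIntegrableFamily 𝓛 ℓ) {s t : ℝ} (hst : s ≤ t)
    (x : Op d) (i j : Fin d) :
    timeEvolution 𝓛 t s x i j =
      x i j + ∫ τ in s..t, 𝓛 τ (timeEvolution 𝓛 τ s x) i j := by
  have h1 : HasSum (fun n => dysonTerm 𝓛 s x (n + 1) t i j)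
      (timeEvolution 𝓛 t s x i j - x i j) := by
    have := (hasSum_nat_add_iff' 1).mpr (h.hasSum_dysonTerm_apply hst x i j)
    simpa [dysonTerm] using this
  have h2 : HasSum (fun n => ∫ τ in s..t, 𝓛 τ (dysonTerm 𝓛 s x n τ) i j)
      (∫ τ in s..t, 𝓛 τ (timeEvolution 𝓛 τ s x) i j) := by
    refine intervalIntegral.hasSum_integral_of_dominated_convergence
      (fun n τ => entryNorm x * (1 / 2) ^ n * (Real.exp (4 * ∫ σ in s..t, ℓ σ) * ℓ τ))
      (fun n => ?_) (fun n => ?_) ?_ ?_ ?_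
    · exact (h.intervalIntegrable_apply _ s t
        (h.continuous_dysonTerm s x n).continuousOn i j).def'.aestronglyMeasurable
    · refine Filter.Eventually.of_forall fun τ hτ => ?_
      rw [Set.uIoc_of_le hst] at hτ
      refine (norm_apply_le_entryNorm _ i j).trans ((h.entryNorm_le τ _).trans ?_)
      have h3 := h.entryNorm_dysonTerm_le s x n hτ.1.le
      have h4 := h.primitive_mono s hτ.2
      simp only at h4
      have h5 := entryNorm_nonneg x
      have h6 : entryNorm (dysonTerm 𝓛 s x n τ) ≤
          entryNorm x * (1 / 2) ^ n * Real.exp (4 * ∫ σ in s..t, ℓ σ) :=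
        h3.trans (by gcongr)
      have := mul_le_mul_of_nonneg_left h6 (h.bound_nonneg τ)
      linarith
    · exact Filter.Eventually.of_forall fun τ _ => summable_bound _ _
    · simp only [tsum_mul_right]
      exact ((h.intervalIntegrable_bound s t).const_mul _).const_mul _
    · refine Filter.Eventually.of_forall fun τ hτ => ?_
      rw [Set.uIoc_of_le hst] at hτ
      have h3 := (h.hasSum_dysonTerm hτ.1.le x).map (𝓛 τ)
        (LinearMap.continuous_of_finiteDimensional (𝓛 τ))
      exact Pi.hasSum.mp (Pi.hasSum.mp h3 i) j
  have h3 := h1.unique h2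
  rw [← h3]; ring

/-- Pairing with a fixed `P` makes the evolution equation scalar; `P` will be the projection frozen
at one time. -/
theorem trace_mul_timeEvolution_sub (h : IsLocallyIntegrableFamily 𝓛 ℓ) {s r t : ℝ} (hsr : s ≤ r)
    (hst : s ≤ t) (x P : Op d) :
    (P * timeEvolution 𝓛 t s x).trace - (P * timeEvolution 𝓛 r s x).trace =
      ∫ τ in r..t, (P * 𝓛 τ (timeEvolution 𝓛 τ s x)).trace := by
  have hint := fun i j => h.intervalIntegrable_timeEvolution x hsr hst i j
  have h1 : ∀ i j, timeEvolution 𝓛 t s x i j - timeEvolution 𝓛 r s x i j =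
      ∫ τ in r..t, 𝓛 τ (timeEvolution 𝓛 τ s x) i j := by
    intro i j
    rw [h.timeEvolution_apply_eq hst, h.timeEvolution_apply_eq hsr, add_sub_add_left_eq_sub]
    exact intervalIntegral.integral_interval_sub_left
      (h.intervalIntegrable_timeEvolution x le_rfl hst i j)
      (h.intervalIntegrable_timeEvolution x le_rfl hsr i j)
  simp only [Matrix.trace, Matrix.diag_apply, Matrix.mul_apply]
  rw [intervalIntegral.integral_finsetSum fun i _ =>
      intervalIntegrable_sum fun k => (hint k i).const_mul (P i k), ← Finset.sum_sub_distrib]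
  refine Finset.sum_congr rfl fun i _ => ?_
  rw [intervalIntegral.integral_finsetSum fun k _ => (hint k i).const_mul _,
    ← Finset.sum_sub_distrib]
  refine Finset.sum_congr rfl fun k _ => ?_
  rw [intervalIntegral.integral_const_mul, ← h1]; ring

theorem intervalIntegrable_trace_mul (h : IsLocallyIntegrableFamily 𝓛 ℓ) {s r t : ℝ}
    (hsr : s ≤ r) (hst : s ≤ t) (x P : Op d) :
    IntervalIntegrable (fun τ => (P * 𝓛 τ (timeEvolution 𝓛 τ s x)).trace) volume r t := by
  simp only [Matrix.trace, Matrix.diag_apply, Matrix.mul_apply]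
  exact intervalIntegrable_sum fun i => intervalIntegrable_sum fun k =>
    (h.intervalIntegrable_timeEvolution x hsr hst k i).const_mul _

theorem timeEvolution_self (h : IsLocallyIntegrableFamily 𝓛 ℓ) (s : ℝ) (x : Op d) :
    timeEvolution 𝓛 s s x = x := by
  ext i j
  rw [h.timeEvolution_apply_eq le_rfl, intervalIntegral.integral_same, add_zero]

theorem trace_timeEvolution (h : IsLocallyIntegrableFamily 𝓛 ℓ)
    (h0 : ∀ τ y, (𝓛 τ y).trace = 0) {s t : ℝ} (hst : s ≤ t) (x : Op d) :
    (timeEvolution 𝓛 t s x).trace = x.trace := by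
  have h1 := h.trace_mul_timeEvolution_sub le_rfl hst x 1
  simp only [one_mul, h0, intervalIntegral.integral_zero, h.timeEvolution_self] at h1
  exact sub_eq_zero.mp h1

theorem isHermitian_timeEvolution (h : IsLocallyIntegrableFamily 𝓛 ℓ)
    (h0 : ∀ τ y, y.IsHermitian → (𝓛 τ y).IsHermitian) {s t : ℝ} (hst : s ≤ t) {x : Op d}
    (hx : x.IsHermitian) : (timeEvolution 𝓛 t s x).IsHermitian := by
  have h1 : ∀ n t, (dysonTerm 𝓛 s x n t).IsHermitian := by
    intro n
    induction n with
    | zero => exact fun _ => hx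
    | succ n ih =>
      intro t
      ext i j
      simp only [dysonTerm, Matrix.conjTranspose_apply, Matrix.of_apply, Complex.star_def]
      rw [← intervalIntegral.intervalIntegral_conj]
      refine intervalIntegral.integral_congr fun τ _ => ?_
      exact (h0 τ _ (ih τ)).apply i j
  have h2 := (h.hasSum_dysonTerm hst x).matrix_conjTranspose
  simp only [fun n => (h1 n t).eq] at h2
  exact h2.unique (h.hasSum_dysonTerm hst x)

end IsLocallyIntegrableFamily

/-! ### Exponential decay of the negative part -/

/-- Turns the linear gain over a short step into an exponential one, at the price of halving the
rate. -/
theorem exp_half_le_one_add {u : ℝ} (h0 : 0 ≤ u) (h1 : u ≤ 1) : Real.exp (u / 2) ≤ 1 + u := by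
  have h2 := Real.add_one_le_exp (-(u / 2))
  have h3 : Real.exp (u / 2) * Real.exp (-(u / 2)) = 1 := by
    rw [← Real.exp_add, add_neg_cancel, Real.exp_zero]
  have h4 := Real.exp_pos (u / 2)
  have h5 : Real.exp (u / 2) * (1 - u / 2) ≤ 1 := by nlinarith
  nlinarith

theorem continuous_entryNorm : Continuous (entryNorm : Op d → ℝ) :=
  continuous_finsetSum _ fun i _ => continuous_finsetSum _ fun j _ =>
    (continuous_id.matrix_elem i j).norm

open Filter Topology Set in
theorem exists_exp_decay (L : Fin m → Op d)
    (hspan : Submodule.span ℂ (Set.range L ∪ Set.range (fun j => (L j).conjTranspose)) = ⊤)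
    {H : ℝ → Op d} (hH : IsHamiltonian H) :
    ∃ γ : ℝ, 0 < γ ∧ ∀ x : Op d, x.IsHermitian → x.trace = 0 → ∀ s b : ℝ, s ≤ b →
      entryNorm (timeEvolution (drivenLindbladian H (dissipator L)) b s x) ≤
        2 * d * d * (Real.exp (-γ * (b - s)) * entryNorm x) := by
  obtain ⟨κ, hκ, hproj⟩ := exists_negative_projection L hspan
  obtain ⟨ℓ, h⟩ := exists_isLocallyIntegrableFamily hH (dissipator L)
  refine ⟨κ / 2, by positivity, fun x hx hx0 s b hsb => ?_⟩
  set 𝓛 := drivenLindbladian H (dissipator L) with h𝓛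
  set X : ℝ → Op d := fun t => timeEvolution 𝓛 t s x with hX
  have hXH : ∀ t, s ≤ t → (X t).IsHermitian := fun t ht =>
    h.isHermitian_timeEvolution
      (fun τ y hy => isHermitian_drivenLindbladian (hH.isHermitian τ) L hy) ht hx
  have hX0 : ∀ t, s ≤ t → (X t).trace = 0 := fun t ht => by
    rw [← hx0]
    exact h.trace_timeEvolution (trace_drivenLindbladian H L) ht x
  choose! P hP1 hP2 hP3 hP4 hP5 using fun t (ht : s ≤ t) => hproj (X t) (hXH t ht) (hX0 t ht)
  set n : ℝ → ℝ := fun t => -(P t * X t).trace.re with hn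
  set G : ℝ → ℝ := fun t => ∫ τ in s..t, ℓ τ with hG
  have hXc : ContinuousOn X (Icc s b) := h.continuousOn_timeEvolution s b x
  have htr : ∀ t, s ≤ t → ∀ A : Op d, |(P t * A).trace.re| ≤ entryNorm A := fun t ht A =>
    (Complex.abs_re_le_norm _).trans
      (norm_trace_mul_le _ _ (norm_apply_le_one_of_isStarProjection (hP1 t ht)))
  -- As a maximum of 1-Lipschitz functionals of `X`, `n` is continuous even if `P` is not.
  have hnlip : ∀ t r, s ≤ t → s ≤ r → n t - n r ≤ entryNorm (X r - X t) := by
    intro t r ht hr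
    have h1 : -(P t * X r).trace.re ≤ n r := hP3 r hr (P t) (hP1 t ht)
    have h2 := (le_abs_self _).trans (htr t ht (X r - X t))
    rw [mul_sub, Matrix.trace_sub, Complex.sub_re] at h2
    simp only [hn] at h1 ⊢
    linarith
  have hdist : ∀ t ∈ Icc s b, Tendsto (fun r => entryNorm (X r - X t)) (𝓝[Icc s b] t) (𝓝 0) := by
    intro t ht
    have h1 : ContinuousWithinAt (fun r => entryNorm (X r - X t)) (Icc s b) t :=
      continuous_entryNorm.continuousAt.comp_continuousWithinAt
        ((hXc t ht).sub continuousWithinAt_const)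
    have h2 : entryNorm (X t - X t) = 0 := by simp [entryNorm]
    simpa only [ContinuousWithinAt, h2] using h1
  have hentry_symm : ∀ A B : Op d, entryNorm (A - B) = entryNorm (B - A) := fun A B => by
    simp only [entryNorm, Matrix.sub_apply, norm_sub_rev]
  have hnc : ContinuousOn n (Icc s b) := by
    intro t ht
    refine tendsto_iff_dist_tendsto_zero.mpr
      (squeeze_zero' (Eventually.of_forall fun _ => dist_nonneg) ?_ (hdist t ht))
    filter_upwards [self_mem_nhdsWithin] with r hr
    rw [Real.dist_eq, abs_le]
    have h1 := hnlip t r ht.1 hr.1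
    have h2 := hnlip r t hr.1 ht.1
    rw [hentry_symm] at h2
    constructor <;> linarith
  -- `P t` commutes with `X t` but not necessarily with `X τ`. Replacing one by the other costs `ε *
  -- ℓ τ`, which is integrable though possibly unbounded.
  have hdecr : ∀ t, s ≤ t → ∀ τ, ∀ ε, entryNorm (X τ - X t) ≤ ε →
      κ * n t - ε * ℓ τ ≤ (P t * 𝓛 τ (X τ)).trace.re := by
    intro t ht τ ε hε
    have h1 : (P t * 𝓛 τ (X t)).trace.re = (P t * dissipator L (X t)).trace.re := by
      rw [h𝓛, drivenLindbladian, LinearMap.add_apply, mul_add, Matrix.trace_add,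
        trace_mul_hamiltonianPart_of_commute _ (hP2 t ht), zero_add]
    have h2 : (P t * 𝓛 τ (X τ)).trace.re =
        (P t * 𝓛 τ (X t)).trace.re + (P t * 𝓛 τ (X τ - X t)).trace.re := by
      rw [← Complex.add_re, ← Matrix.trace_add, ← mul_add, ← map_add, add_sub_cancel]
    have h3 := (abs_le.mp (htr t ht (𝓛 τ (X τ - X t)))).1
    have h4 := h.entryNorm_le τ (X τ - X t)
    have h5 := mul_le_mul_of_nonneg_left hε (h.bound_nonneg τ)
    have h6 := hP4 t ht
    simp only [hn]
    rw [h2, h1]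
    linarith
  have hstep : ∀ ε : ℝ, 0 < ε → ∀ t ∈ Ioc s b, ∀ᶠ r in 𝓝[<] t, s ≤ r →
      Real.exp (κ / 2 * (t - r)) * n t - ε * (G t - G r) ≤ n r := by
    intro ε hε t ht
    have ht' : t ∈ Icc s b := ⟨ht.1.le, ht.2⟩
    obtain ⟨δ, hδ, hball⟩ := Metric.mem_nhdsWithin_iff.mp
      ((hdist t ht').eventually_le_const hε)
    -- `δ` keeps `X` within `ε` of `X t`; `1 / κ` makes `exp_half_le_one_add` applicable.
    have h1 : ∀ᶠ r in 𝓝[<] t, r ∈ Ioo (t - min δ (1 / κ)) t :=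
      Ioo_mem_nhdsLT (by have : 0 < min δ (1 / κ) := by positivity
                         linarith)
    filter_upwards [h1] with r hr hsr
    have hrt : r ≤ t := hr.2.le
    have hδr : t - r < δ := by have := min_le_left δ (1 / κ); linarith [hr.1]
    have hκr : κ * (t - r) ≤ 1 := by
      have h2 : t - r ≤ 1 / κ := by have := min_le_right δ (1 / κ); linarith [hr.1]
      rw [le_div_iff₀ hκ] at h2
      linarith
    have hκr0 : 0 ≤ κ * (t - r) := mul_nonneg hκ.le (by linarith)
    have hnear : ∀ τ ∈ Icc r t, entryNorm (X τ - X t) ≤ ε := fun τ hτ =>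
      hball ⟨by rw [Metric.mem_ball, Real.dist_eq, abs_lt]; constructor <;> linarith [hτ.1, hτ.2],
        ⟨hsr.trans hτ.1, hτ.2.trans ht.2⟩⟩
    have hint := h.intervalIntegrable_trace_mul hsr ht'.1 x (P t)
    have h2 : (P t * X t).trace.re - (P t * X r).trace.re =
        ∫ τ in r..t, (P t * 𝓛 τ (X τ)).trace.re := by
      rw [← Complex.sub_re, h.trace_mul_timeEvolution_sub hsr ht'.1]
      exact (intervalIntegral.intervalIntegral_re hint).symm
    have h3 : ∫ τ in r..t, (κ * n t - ε * ℓ τ) ≤ ∫ τ in r..t, (P t * 𝓛 τ (X τ)).trace.re := by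
      refine intervalIntegral.integral_mono_on hrt
        (intervalIntegrable_const.sub ((h.intervalIntegrable_bound r t).const_mul ε))
        ?_ fun τ hτ => hdecr t ht'.1 τ ε (hnear τ hτ)
      exact ⟨hint.1.re, hint.2.re⟩
    rw [intervalIntegral.integral_sub intervalIntegrable_const
        ((h.intervalIntegrable_bound r t).const_mul ε), intervalIntegral.integral_const,
      intervalIntegral.integral_const_mul, ← h.primitive_sub s r t, smul_eq_mul] at h3
    have h4 : -(P t * X r).trace.re ≤ n r := hP3 r hsr (P t) (hP1 t ht'.1)
    have h5 : 0 ≤ n t := by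
      -- The zero projection shows that the maximum is nonnegative.
      have h6 := hP3 t ht'.1 0 ⟨by simp [IsIdempotentElem], by simp⟩
      simpa [hn] using h6
    have h7 := mul_le_mul_of_nonneg_right (exp_half_le_one_add hκr0 hκr) h5
    have h8 : κ / 2 * (t - r) = κ * (t - r) / 2 := by ring
    have h9 : n t = -(P t * X t).trace.re := rfl
    rw [h8]
    simp only [hG]
    linarith
  have hmain : ∀ ε : ℝ, 0 < ε → Real.exp (κ / 2 * (b - s)) * n b ≤
      n s + ε * (Real.exp (κ / 2 * (b - s)) * G b) := by
    intro ε hε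
    -- The error term carries the weight at `b`, the largest on the interval, so the local errors
    -- telescope through `G`.
    have key := le_of_eventually_nhdsLT_le (g := fun t => Real.exp (κ / 2 * (t - s)) * n t -
      ε * (Real.exp (κ / 2 * (b - s)) * G t)) hsb ?_ ?_
    · simp only [hG, sub_self, mul_zero, Real.exp_zero, one_mul, sub_zero,
        intervalIntegral.integral_same] at key
      simp only [hG]
      linarith
    · exact (ContinuousOn.mul (by fun_prop) hnc).sub
        (((h.continuous_primitive s).const_mul _).const_mul _).continuousOn
    · intro t ht
      filter_upwards [hstep ε hε t ht, self_mem_nhdsWithin] with r hr hrt hsr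
      have hrt' : r ≤ t := le_of_lt hrt
      have h1 := mul_le_mul_of_nonneg_left (hr hsr) (Real.exp_pos (κ / 2 * (r - s))).le
      have h2 : Real.exp (κ / 2 * (t - s)) =
          Real.exp (κ / 2 * (r - s)) * Real.exp (κ / 2 * (t - r)) := by
        rw [← Real.exp_add]; congr 1; ring
      have h3 : Real.exp (κ / 2 * (r - s)) ≤ Real.exp (κ / 2 * (b - s)) := by
        have := ht.2
        gcongr
        linarith
      have h4 : 0 ≤ ε * (G t - G r) :=
        mul_nonneg hε.le (sub_nonneg.mpr (h.primitive_mono s hrt'))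
      have h5 := mul_le_mul_of_nonneg_right h3 h4
      rw [h2]
      linarith
  have hlim : Real.exp (κ / 2 * (b - s)) * n b ≤ n s := by
    have h1 : Tendsto (fun ε : ℝ => n s + ε * (Real.exp (κ / 2 * (b - s)) * G b)) (𝓝[>] 0)
        (𝓝 (n s + 0 * (Real.exp (κ / 2 * (b - s)) * G b))) :=
      (Continuous.tendsto (by fun_prop) 0).mono_left nhdsWithin_le_nhds
    rw [zero_mul, add_zero] at h1
    exact ge_of_tendsto h1 (by filter_upwards [self_mem_nhdsWithin] with ε hε using hmain ε hε)
  have hns : n s ≤ entryNorm x := by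
    have h1 := (neg_le_abs _).trans (htr s le_rfl (X s))
    have h2 : entryNorm (X s) = entryNorm x := congrArg entryNorm (h.timeEvolution_self s x)
    exact h1.trans_eq h2
  have hnb : n b ≤ Real.exp (-(κ / 2) * (b - s)) * entryNorm x := by
    rw [neg_mul, Real.exp_neg, inv_mul_eq_div, le_div_iff₀ (Real.exp_pos _), mul_comm]
    exact hlim.trans hns
  exact (hP5 b hsb).trans (mul_le_mul_of_nonneg_left hnb (by positivity))

end Lindblad

theorem mainTheorem9 {d m : ℕ} (L : Fin m → Lindblad.Op d)
    (hspan : {X : Lindblad.Op d | X = -X.conjTranspose} ⊆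
      (Submodule.span ℂ (Set.range L ∪ Set.range (fun j => (L j).conjTranspose)) :
        Set (Lindblad.Op d))) :
    Lindblad.HamiltonianIndependentlyContractive (Lindblad.dissipator L) := by
  intro H hH
  obtain ⟨γ, hγ, hdecay⟩ := Lindblad.exists_exp_decay L
    (Lindblad.span_eq_top_of_antiHermitian_subset hspan) hH
  -- The product combines the two norm comparisons with the decay constant; the `+ 1` gives
  -- positivity when `d = 0`.
  refine ⟨d * (2 * d * d * (d * d)) + 1, γ, by positivity, hγ, fun ρ σ hρ hσ s t _ hst => ?_⟩
  have h1 := hdecay (ρ - σ) (hρ.1.isHermitian.sub hσ.1.isHermitian)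
    (by rw [Matrix.trace_sub, hρ.2, hσ.2, sub_self]) s t hst
  have h2 := Lindblad.entryNorm_le_traceNorm (ρ - σ)
  have h3 := Lindblad.traceNorm_nonneg (ρ - σ)
  rw [abs_of_nonneg (sub_nonneg.mpr hst)]
  set E := Real.exp (-γ * (t - s))
  have hE : 0 < E := Real.exp_pos _
  calc _ ≤ d * Lindblad.entryNorm _ := Lindblad.traceNorm_le _
    _ ≤ d * (2 * d * d * (E * Lindblad.entryNorm (ρ - σ))) := by gcongr
    _ ≤ d * (2 * d * d * (E * (d * d * Lindblad.traceNorm (ρ - σ)))) := by gcongr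
    _ = d * (2 * d * d * (d * d)) * E * Lindblad.traceNorm (ρ - σ) := by ring
    _ ≤ _ := by
      gcongr
      linarith
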